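/- Let $d\ge 1$ and let $\widehat D=\{r\in\mathbb R^d : r_j\ge -1,\ \sum_{j=1}^d (1+r_j)/2\le 1\}$ be the bi-unit right simplex, with barycentric coordinates $b_j=(1+r_j)/2$ $(1\le j\le d)$ and $b_0=1-\sum_{j=1}^d b_j$. Let $P^n$ be the space of real polynomials on $\widehat D$ of total degree at most $n$, with Bernstein basis $B^n_\alpha=\frac{n!}{\alpha_0!\cdots\alpha_d!}\prod_{j=0}^d b_j^{\alpha_j}$, $\alpha\in\mathbb N^{d+1}$, $|\alpha|=n$, and mass matrix $(M_n)_{\alpha\beta}=\int_{\widehat D}B^n_\alpha B^n_\beta$. Let $(L_\gamma)_{\gamma\in\mathbb N^d}$ be a hierarchical orthogonal (modal) basis: the $L_\gamma$ are linearly independent, $\int_{\widehat D}L_\nu L_\gamma=0$ for $\nu\ne\gamma$, and $L_\gamma\in P^n$ whenever $|\gamma|\le n$; thus $(L_\gamma)_{|\gamma|\le n}$ is a basis of $P^n$ for every $n$. Let $T_n$ be the change of basis $c^B=T_nc^L$ between the coefficients of $p=\sum_{|\gamma|\le n}c^L_\gamma L_\gamma=\sum_{|\alpha|=n}c^B_\alpha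 B^n_\alpha\in P^n$. For $m\le n$ let $E_m^n$ be the degree elevation matrix, which maps the degree-$m$ Bernstein coefficients of a polynomial $p\in P^m$ to its degree-$n$ Bernstein coefficients. For every $n\ge 0$ the matrix $M_n$ has exactly $n+1$ distinct eigenvalues $\lambda^n_0>\lambda^n_1>\dots>\lambda^n_n>0$, and for $0\le k\le n$ the eigenspace of $\lambda^n_k$ consists of exactly the Bernstein coefficient vectors of the $p\in P^k$ that are orthogonal in $L^2(\widehat D)$ to all polynomials of total degree less than $k$. Moreover, for all $0\le i\le N$, $$T_{N-i}^{-1}\,(E_{N-i}^N)^T\,T_N=\tilde D,$$ where $\tilde D$ is the rectangular diagonal matrix, with rows indexed by $\nu\in\mathbb N^d$, $|\nu|\le N-i$, and columns by $\gamma\in\mathbb N^d$, $|\gamma|\le N$, given by $$\tilde D_{\nu,\gamma}=\begin{cases}\lambda^{N-i}_{|\gamma|}/\lambda^{N}_{|\gamma|}, & \nu=\gamma,\\ 0,&\text{otherwise.}\end{cases}$$ -/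

import Mathlib

open scoped Matrix

noncomputable section

namespace BernsteinModal

/-- Barycentric multi-indices `α = (α₀, …, α_d)` with `|α| = N`. -/
abbrev BernIdx (d N : ℕ) : Type := {α : Fin (d + 1) → ℕ // ∑ j, α j = N}

/-- Modal multi-indices `γ = (γ₁, …, γ_d)` with `|γ| ≤ N`. -/
abbrev ModalIdx (d N : ℕ) : Type := {γ : Fin d → ℕ // ∑ j, γ j ≤ N}

instance instFiniteModalIdx (d N : ℕ) : Finite (ModalIdx d N) := by
  refine Finite.of_injective
    (fun γ : ModalIdx d N => fun j : Fin d => (⟨γ.1 j, ?_⟩ : Fin (N + 1))) ?_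
  · have := Finset.single_le_sum (f := γ.1) (fun _ _ => Nat.zero_le _) (Finset.mem_univ j)
    have := γ.2
    omega
  · intro γ ν h
    ext j
    simpa using congrFun h j

/-- Dropping the zeroth entry identifies the two index sets. -/
def bernIdxEquiv (d N : ℕ) : BernIdx d N ≃ ModalIdx d N where
  toFun α := ⟨Fin.tail α.1, by
    have := α.2
    rw [Fin.sum_univ_succ] at this
    simp only [Fin.tail]
    omega⟩
  invFun γ := ⟨Fin.cons (N - ∑ j, γ.1 j) γ.1, by
    have := γ.2
    rw [Fin.sum_univ_succ]
    simp only [Fin.cons_zero, Fin.cons_succ]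
    omega⟩
  left_inv α := by
    apply Subtype.ext
    funext j
    have := α.2
    rw [Fin.sum_univ_succ] at this
    refine Fin.cases ?_ (fun k => ?_) j
    · simp only [Fin.tail, Fin.cons_zero]
      omega
    · simp [Fin.tail]
  right_inv γ := by
    apply Subtype.ext
    funext j
    simp [Fin.tail]

instance instFintypeModalIdx (d N : ℕ) : Fintype (ModalIdx d N) := Fintype.ofFinite _

instance instFintypeBernIdx (d N : ℕ) : Fintype (BernIdx d N) :=
  Fintype.ofEquiv _ (bernIdxEquiv d N).symm

/-- `P^N`: real polynomials in `d` variables of total degree at most `N`. -/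
abbrev P (d N : ℕ) : Submodule ℝ (MvPolynomial (Fin d) ℝ) :=
  MvPolynomial.restrictTotalDegree (Fin d) ℝ N

/-- The barycentric coordinates of the bi-unit right simplex, as polynomials in the
reference coordinates: `λ_{i} = (1 + r_i) / 2` for `1 ≤ i ≤ d` and
`λ₀ = 1 - ∑ (1 + r_i) / 2`. -/
def bary (d : ℕ) : Fin (d + 1) → MvPolynomial (Fin d) ℝ :=
  Fin.cons (1 - ∑ i, MvPolynomial.C (1 / 2 : ℝ) * (1 + MvPolynomial.X i))
    (fun i => MvPolynomial.C (1 / 2 : ℝ) * (1 + MvPolynomial.X i))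

/-- The bi-unit right simplex `{r : r_i ≥ -1, ∑ (1 + r_i) / 2 ≤ 1}`. -/
def refSimplex (d : ℕ) : Set (Fin d → ℝ) :=
  {r | (∀ i, -1 ≤ r i) ∧ ∑ i, (1 + r i) / 2 ≤ 1}

/-- The `L²` inner product of polynomials on the reference simplex. -/
def l2 {d : ℕ} (p q : MvPolynomial (Fin d) ℝ) : ℝ :=
  ∫ r in refSimplex d, MvPolynomial.eval r p * MvPolynomial.eval r q

/-- The Bernstein polynomial `B^{|α|}_α = (|α|! / ∏ α_j!) ∏ λ_j ^ α_j`. -/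
def bern {d : ℕ} (α : Fin (d + 1) → ℕ) : MvPolynomial (Fin d) ℝ :=
  MvPolynomial.C (((∑ j, α j).factorial : ℝ) / (∏ j, ((α j).factorial : ℝ))) *
    ∏ j, bary d j ^ α j

lemma sum_bary (d : ℕ) : ∑ j, bary d j = 1 := by
  rw [Fin.sum_univ_succ]
  simp [bary]

lemma totalDegree_bary_le (d : ℕ) (j : Fin (d + 1)) : (bary d j).totalDegree ≤ 1 := by
  have h : ∀ i : Fin d, (MvPolynomial.C (1 / 2 : ℝ) *
      (1 + MvPolynomial.X i) : MvPolynomial (Fin d) ℝ).totalDegree ≤ 1 := by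
    intro i
    refine (MvPolynomial.totalDegree_mul _ _).trans ?_
    rw [MvPolynomial.totalDegree_C, zero_add]
    refine (MvPolynomial.totalDegree_add _ _).trans ?_
    simp
  refine Fin.cases ?_ (fun i => ?_) j
  · simp only [bary, Fin.cons_zero]
    refine (MvPolynomial.totalDegree_sub _ _).trans ?_
    refine max_le (by simp) ?_
    exact MvPolynomial.totalDegree_finsetSum_le (fun i _ => h i)
  · simpa only [bary, Fin.cons_succ] using h i

lemma bern_mem (d N : ℕ) (α : BernIdx d N) : bern α.1 ∈ P d N := by
  rw [MvPolynomial.mem_restrictTotalDegree]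
  refine (MvPolynomial.totalDegree_mul _ _).trans ?_
  rw [MvPolynomial.totalDegree_C, zero_add]
  refine (MvPolynomial.totalDegree_finsetProd _ _).trans ?_
  calc ∑ j, (bary d j ^ α.1 j).totalDegree ≤ ∑ j, α.1 j := by
        refine Finset.sum_le_sum (fun j _ => ?_)
        refine (MvPolynomial.totalDegree_pow _ _).trans ?_
        have := totalDegree_bary_le d j
        nlinarith
    _ = N := α.2
    _ ≤ N := le_rfl

/-- The span of the Bernstein polynomials of degree `N`. -/
def bernSpan (d N : ℕ) : Submodule ℝ (MvPolynomial (Fin d) ℝ) :=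
  Submodule.span ℝ (Set.range (fun α : BernIdx d N => bern α.1))

lemma prod_mem_bernSpan (d N : ℕ) (α : BernIdx d N) :
    ∏ j, bary d j ^ α.1 j ∈ bernSpan d N := by
  set c : ℝ := ((∑ j, α.1 j).factorial : ℝ) / (∏ j, ((α.1 j).factorial : ℝ)) with hc
  have hc0 : c ≠ 0 := by
    have h1 : ((∑ j, α.1 j).factorial : ℝ) ≠ 0 := by positivity
    have h2 : (∏ j, ((α.1 j).factorial : ℝ)) ≠ 0 := by positivity
    exact div_ne_zero h1 h2
  have h : ∏ j, bary d j ^ α.1 j = c⁻¹ • bern α.1 := by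
    rw [bern, ← hc, ← MvPolynomial.smul_eq_C_mul, smul_smul, inv_mul_cancel₀ hc0, one_smul]
  rw [h]
  exact Submodule.smul_mem _ _ (Submodule.subset_span ⟨α, rfl⟩)

lemma bary_mul_mem (d N : ℕ) (j : Fin (d + 1)) {p : MvPolynomial (Fin d) ℝ}
    (hp : p ∈ bernSpan d N) : bary d j * p ∈ bernSpan d (N + 1) := by
  induction hp using Submodule.span_induction with
  | mem x hx =>
    obtain ⟨α, rfl⟩ := hx
    let β : BernIdx d (N + 1) := ⟨α.1 + Pi.single j 1, by
      simp [Finset.sum_add_distrib, α.2]⟩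
    have hβ : ∏ k, bary d k ^ β.1 k = bary d j * ∏ k, bary d k ^ α.1 k := by
      simp only [β, Pi.add_apply, pow_add, Finset.prod_mul_distrib]
      rw [mul_comm]
      congr 1
      rw [Finset.prod_eq_single j] <;> simp +contextual
    simp only [bern]
    rw [mul_left_comm, ← hβ, ← MvPolynomial.smul_eq_C_mul]
    exact Submodule.smul_mem _ _ (prod_mem_bernSpan d (N + 1) β)
  | zero => simp
  | add x y _ _ hx hy =>
    rw [mul_add]
    exact Submodule.add_mem _ hx hy
  | smul a x _ hx =>
    rw [mul_smul_comm]
    exact Submodule.smul_mem _ _ hx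

lemma bernSpan_le_succ (d N : ℕ) : bernSpan d N ≤ bernSpan d (N + 1) := by
  intro p hp
  have h : p = ∑ j, bary d j * p := by
    rw [← Finset.sum_mul, sum_bary, one_mul]
  rw [h]
  exact Submodule.sum_mem _ (fun j _ => bary_mul_mem d N j hp)

lemma X_mul_mem (d N : ℕ) (i : Fin d) {p : MvPolynomial (Fin d) ℝ}
    (hp : p ∈ bernSpan d N) : MvPolynomial.X i * p ∈ bernSpan d (N + 1) := by
  have hC : (MvPolynomial.C (2 : ℝ) : MvPolynomial (Fin d) ℝ) * MvPolynomial.C (1 / 2 : ℝ) = 1 := by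
    rw [← MvPolynomial.C_mul]
    norm_num
  have h : MvPolynomial.X i * p = (2 : ℝ) • (bary d i.succ * p) - p := by
    simp only [bary, Fin.cons_succ, MvPolynomial.smul_eq_C_mul]
    linear_combination (-(1 + MvPolynomial.X i) * p) * hC
  rw [h]
  exact Submodule.sub_mem _ (Submodule.smul_mem _ _ (bary_mul_mem d N i.succ hp))
    (bernSpan_le_succ d N hp)

lemma one_mem_bernSpan (d N : ℕ) : (1 : MvPolynomial (Fin d) ℝ) ∈ bernSpan d N := by
  induction N with
  | zero => simpa using prod_mem_bernSpan d 0 ⟨0, by simp⟩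
  | succ n ih => exact bernSpan_le_succ d n ih

lemma monomial_mem_bernSpan (d : ℕ) : ∀ (N : ℕ) (m : Fin d →₀ ℕ),
    ∑ j, m j ≤ N → MvPolynomial.monomial m (1 : ℝ) ∈ bernSpan d N := by
  intro N
  induction N with
  | zero =>
    intro m hm
    have : m = 0 := by
      ext j
      have := Finset.single_le_sum (f := fun j => m j) (fun _ _ => Nat.zero_le _)
        (Finset.mem_univ j)
      simp only [Finsupp.coe_zero, Pi.zero_apply]
      omega
    subst this
    exact one_mem_bernSpan d 0
  | succ n ih =>
    intro m hm
    by_cases h0 : m = 0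
    · subst h0
      exact one_mem_bernSpan d (n + 1)
    · obtain ⟨i, hi⟩ := Finsupp.ne_iff.mp h0
      have hi' : Finsupp.single i 1 ≤ m := by
        rw [Finsupp.single_le_iff]
        exact Nat.one_le_iff_ne_zero.mpr hi
      have hm' : m = Finsupp.single i 1 + (m - Finsupp.single i 1) :=
        (add_tsub_cancel_of_le hi').symm
      have hs : ∑ j, m j = 1 + ∑ j, (m - Finsupp.single i 1 : Fin d →₀ ℕ) j := by
        conv_lhs => rw [hm']
        simp only [Finsupp.add_apply, Finset.sum_add_distrib]
        congr 1
        simp [Finsupp.single_apply]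
      have hX : MvPolynomial.monomial m (1 : ℝ) =
          MvPolynomial.X i * MvPolynomial.monomial (m - Finsupp.single i 1) (1 : ℝ) := by
        conv_lhs => rw [hm']
        rw [MvPolynomial.X, MvPolynomial.monomial_mul, one_mul]
      rw [hX]
      exact X_mul_mem d n i (ih _ (by omega))

lemma P_le_bernSpan (d N : ℕ) : P d N ≤ bernSpan d N := by
  rw [P, MvPolynomial.restrictTotalDegree, MvPolynomial.restrictSupport_eq_span,
    Submodule.span_le]
  rintro _ ⟨m, hm, rfl⟩
  refine monomial_mem_bernSpan d N m ?_
  rwa [Set.mem_ofPred_eq, Finsupp.sum_fintype _ _ (fun _ => rfl)] at hm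

/-- Exponents of the monomials spanning `P^N`. -/
def exponentEquiv (d N : ℕ) :
    {m : Fin d →₀ ℕ | (m.sum fun _ e => e) ≤ N} ≃ ModalIdx d N :=
  Finsupp.equivFunOnFinite.subtypeEquiv (fun m => by
    rw [Set.mem_ofPred_eq, Finsupp.sum_fintype _ _ (fun _ => rfl)]
    rfl)

lemma finrank_P (d N : ℕ) : Module.finrank ℝ (P d N) = Fintype.card (ModalIdx d N) :=
  Module.finrank_eq_card_basis
    ((MvPolynomial.basisRestrictSupport ℝ _).reindex (exponentEquiv d N))

lemma card_bernIdx (d N : ℕ) : Fintype.card (BernIdx d N) = Module.finrank ℝ (P d N) := by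
  rw [finrank_P]
  exact Fintype.card_congr (bernIdxEquiv d N)

lemma top_le_span_bern (d N : ℕ) :
    ⊤ ≤ Submodule.span ℝ
      (Set.range (fun α : BernIdx d N => (⟨bern α.1, bern_mem d N α⟩ : P d N))) := by
  rintro ⟨p, hp⟩ -
  have h : p ∈ bernSpan d N := P_le_bernSpan d N hp
  rw [← Submodule.apply_mem_span_image_iff_mem_span (P d N).injective_subtype,
    ← Set.range_comp]
  exact h

/-- The Bernstein basis `{B^N_α : |α| = N}` of `P^N`. -/
def bernBasis (d N : ℕ) : Module.Basis (BernIdx d N) ℝ (P d N) :=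
  basisOfTopLeSpanOfCardEqFinrank
    (fun α => ⟨bern α.1, bern_mem d N α⟩) (top_le_span_bern d N) (card_bernIdx d N)

theorem bernBasis_apply (d N : ℕ) (α : BernIdx d N) :
    (bernBasis d N α : MvPolynomial (Fin d) ℝ) = bern α.1 := by
  simp [bernBasis]

/-- `L` is a hierarchical orthogonal (modal) basis: the `L_γ` are linearly independent and
pairwise orthogonal on the reference simplex (no normalization is imposed), and
`L_γ ∈ P^N` for every `N ≥ |γ|`. -/
structure IsModalBasis {d : ℕ} (L : (Fin d → ℕ) → MvPolynomial (Fin d) ℝ) : Prop where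
  linearIndependent : LinearIndependent ℝ L
  mem : ∀ (N : ℕ) (γ : Fin d → ℕ), ∑ j, γ j ≤ N → L γ ∈ P d N
  orthogonal : ∀ ν γ : Fin d → ℕ, ν ≠ γ → l2 (L ν) (L γ) = 0

/-- The modal basis `{L_γ : |γ| ≤ N}` of `P^N`. -/
def modalBasis {d : ℕ} {L : (Fin d → ℕ) → MvPolynomial (Fin d) ℝ} (hL : IsModalBasis L)
    (N : ℕ) : Module.Basis (ModalIdx d N) ℝ (P d N) :=
  haveI : Nonempty (ModalIdx d N) := ⟨⟨0, by simp⟩⟩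
  basisOfLinearIndependentOfCardEqFinrank
    (b := fun γ : ModalIdx d N => (⟨L γ.1, hL.mem N γ.1 γ.2⟩ : P d N))
    (LinearIndependent.of_comp (P d N).subtype
      (hL.linearIndependent.comp (fun γ : ModalIdx d N => γ.1) Subtype.val_injective))
    (finrank_P d N).symm

theorem modalBasis_apply {d : ℕ} {L : (Fin d → ℕ) → MvPolynomial (Fin d) ℝ}
    (hL : IsModalBasis L) (N : ℕ) (γ : ModalIdx d N) :
    (modalBasis hL N γ : MvPolynomial (Fin d) ℝ) = L γ.1 := by
  simp [modalBasis]

/-- The change of basis `T_N`: column `γ` holds the degree `N` Bernstein coefficients of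
`L_γ`. -/
def T {d : ℕ} {L : (Fin d → ℕ) → MvPolynomial (Fin d) ℝ} (hL : IsModalBasis L) (N : ℕ) :
    Matrix (BernIdx d N) (ModalIdx d N) ℝ :=
  (bernBasis d N).toMatrix (modalBasis hL N)

/-- The inverse `T_N⁻¹`: column `α` holds the modal coefficients of `B^N_α`. -/
def Tinv {d : ℕ} {L : (Fin d → ℕ) → MvPolynomial (Fin d) ℝ} (hL : IsModalBasis L) (N : ℕ) :
    Matrix (ModalIdx d N) (BernIdx d N) ℝ :=
  (modalBasis hL N).toMatrix (bernBasis d N)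

/-- `c^B = T c^L`. -/
theorem T_mulVec {d : ℕ} {L : (Fin d → ℕ) → MvPolynomial (Fin d) ℝ} (hL : IsModalBasis L)
    (N : ℕ) (p : P d N) : T hL N *ᵥ (modalBasis hL N).repr p = (bernBasis d N).repr p :=
  Module.Basis.toMatrix_mulVec_repr _ _ _

theorem T_mul_Tinv {d : ℕ} {L : (Fin d → ℕ) → MvPolynomial (Fin d) ℝ} (hL : IsModalBasis L)
    (N : ℕ) : T hL N * Tinv hL N = 1 :=
  Module.Basis.toMatrix_mul_toMatrix_flip _ _

theorem Tinv_mul_T {d : ℕ} {L : (Fin d → ℕ) → MvPolynomial (Fin d) ℝ} (hL : IsModalBasis L)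
    (N : ℕ) : Tinv hL N * T hL N = 1 :=
  Module.Basis.toMatrix_mul_toMatrix_flip _ _

lemma P_mono (d : ℕ) {m n : ℕ} (h : m ≤ n) : P d m ≤ P d n := by
  intro p hp
  rw [MvPolynomial.mem_restrictTotalDegree] at hp ⊢
  exact hp.trans h

/-- The degree elevation operator `E_m^n`, `m ≤ n`: the matrix, with respect to the Bernstein
bases, of the inclusion of `P^m` into `P^n`. -/
def elev (d : ℕ) {m n : ℕ} (h : m ≤ n) : Matrix (BernIdx d n) (BernIdx d m) ℝ :=
  LinearMap.toMatrix (bernBasis d m) (bernBasis d n)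
    (Submodule.inclusion (P_mono d h))

/-- Column `β` of `E_m^n` holds the degree `n` Bernstein coefficients of `B^m_β`. -/
theorem sum_elev_bern (d : ℕ) {m n : ℕ} (h : m ≤ n) (β : BernIdx d m) :
    bern β.1 = ∑ α : BernIdx d n, elev d h α β • bern α.1 := by
  have h1 := (bernBasis d n).sum_repr
    (Submodule.inclusion (P_mono d h)
      (bernBasis d m β))
  have h2 := congrArg (Submodule.subtype _) h1
  simp only [map_sum, map_smul, Submodule.subtype_apply, bernBasis_apply] at h2
  have h3 : bern β.1 = (bernBasis d m β : MvPolynomial (Fin d) ℝ) :=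
    (bernBasis_apply d m β).symm
  refine h3.trans (Eq.trans h2.symm ?_)
  refine Finset.sum_congr rfl (fun α _ => ?_)
  rw [elev, LinearMap.toMatrix_apply]

/-- The Bernstein mass matrix `M_N`. -/
def mass (d N : ℕ) : Matrix (BernIdx d N) (BernIdx d N) ℝ :=
  Matrix.of fun α β => l2 (bern α.1) (bern β.1)

/-- The finite set of distinct eigenvalues of the mass matrix `M_N`. -/
def massEigenvalues (d N : ℕ) : Finset ℝ :=
  (Module.End.finite_hasEigenvalue (Matrix.toLin' (mass d N))).toFinset

/-- `λ^N_k`: the distinct eigenvalues of `M_N` listed in decreasing order, counted from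
`k = 0` (with the value `0` if there are at most `k` distinct eigenvalues). -/
def eig (d N k : ℕ) : ℝ :=
  ((massEigenvalues d N).sort (· ≥ ·)).getD k 0

/-- The polynomial with Bernstein coefficient vector `c`. -/
def ofBernCoeff {d N : ℕ} (c : BernIdx d N → ℝ) : MvPolynomial (Fin d) ℝ :=
  ∑ α, c α • bern α.1

/-- The rectangular diagonal matrix with entry `λ^n_{|γ|} / λ^N_{|γ|}` at `ν = γ` and `0`
elsewhere. -/
def Dtilde (d n N : ℕ) : Matrix (ModalIdx d n) (ModalIdx d N) ℝ :=
  Matrix.of fun ν γ =>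
    if ν.1 = γ.1 then eig d n (∑ j, γ.1 j) / eig d N (∑ j, γ.1 j) else 0

end BernsteinModal

end

open scoped Matrix

noncomputable section

namespace BernsteinModal

open MeasureTheory

/-! In Bernstein coordinates the mass matrix is the Bernstein–Durrmeyer operator `p ↦ ∑ ⟨B_α, p⟩
B_α` (`ofBernCoeff_mass_mulVec`), which is symmetric for the `L²` product. By the Dirichlet
integral, the moment of `B_α` against `b^μ` is a constant times a product of rising factorials `(α_j
+ 1)⋯(α_j + μ_j)`. Vandermonde rewrites these as falling factorials of `α`, and the sums of the
`B_α` weighted by falling factorials are multiples of barycentric monomials. So the operator is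
triangular in the degree, with diagonal entry `durrmeyerEig d n k = 2^d n! n(n-1)⋯(n-k+1) /
(n+k+d)!`.

Symmetry and triangularity make every degree-`k` polynomial orthogonal to lower degrees an
eigenvector (`durrmeyer_eq_smul`). Hence the `L_γ` diagonalize all the operators at once. The
eigenvalues strictly decrease in `k ≤ n`, so they are distinct and the eigenspaces are as claimed.

For degree elevation, `Eᵀ M_N` sends the coefficients of `p` to its moments against the `B^m_β`. On
`L_γ` these moments are `λ^m_{|γ|}` times its degree-`m` coefficients, or `0` if `|γ| > m`, while
`M_N` only multiplies by `λ^N_{|γ|}`. -/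

/-! ### Beta and Dirichlet integrals -/

lemma integral_pow_mul_sub_pow (s : ℝ) (a : ℕ) : ∀ b : ℕ,
    ∫ y in (0 : ℝ)..s, y ^ a * (s - y) ^ b =
      (a.factorial * b.factorial : ℝ) / (a + b + 1).factorial * s ^ (a + b + 1) := by
  induction a with
  | zero =>
    intro b
    have h : ∀ y ∈ Set.uIcc 0 s, HasDerivAt (fun y : ℝ => -(s - y) ^ (b + 1) / (b + 1))
        (y ^ 0 * (s - y) ^ b) y := by
      intro y _
      have h1 := ((((hasDerivAt_id y).const_sub s).fun_pow (b + 1)).fun_neg).div_const (b + 1 : ℝ)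
      refine h1.congr_deriv ?_
      have : (b + 1 : ℝ) ≠ 0 := by positivity
      simp
      field_simp
    rw [intervalIntegral.integral_eq_sub_of_hasDerivAt h
      (by apply Continuous.intervalIntegrable; fun_prop)]
    have h1 : (b.factorial : ℝ) ≠ 0 := by positivity
    simp only [Nat.factorial, zero_add, Nat.cast_mul, Nat.cast_one]
    field_simp
    simp [mul_comm]
  | succ a ih =>
    intro b
    -- The product vanishes at both endpoints, so integrating its derivative gives `(a+1) I(a, b+1)
    -- = (b+1) I(a+1, b)`.
    have h : ∀ y ∈ Set.uIcc 0 s, HasDerivAt (fun y : ℝ => y ^ (a + 1) * (s - y) ^ (b + 1))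
        ((a + 1) * (y ^ a * (s - y) ^ (b + 1)) - (b + 1) * (y ^ (a + 1) * (s - y) ^ b)) y := by
      intro y _
      have h1 := ((hasDerivAt_id y).fun_pow (a + 1)).fun_mul
        (((hasDerivAt_id y).const_sub s).fun_pow (b + 1))
      refine h1.congr_deriv ?_
      simp
      ring
    have h2 := intervalIntegral.integral_eq_sub_of_hasDerivAt h
      (by apply Continuous.intervalIntegrable; fun_prop)
    rw [intervalIntegral.integral_sub (by apply Continuous.intervalIntegrable; fun_prop)
      (by apply Continuous.intervalIntegrable; fun_prop), intervalIntegral.integral_const_mul,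
      intervalIntegral.integral_const_mul, ih (b + 1)] at h2
    have e : a + (b + 1) + 1 = a + 1 + b + 1 := by ring
    rw [e] at h2
    have h1 : ((a + 1 + b + 1).factorial : ℝ) ≠ 0 := by positivity
    have h3 : (b + 1 : ℝ) ≠ 0 := by positivity
    refine mul_left_cancel₀ h3 ?_
    simp only [sub_self, zero_pow (Nat.succ_ne_zero _), mul_zero, zero_mul, sub_zero] at h2
    rw [← sub_eq_zero.mp h2]
    simp only [Nat.factorial_succ a, Nat.factorial_succ b, Nat.cast_mul, Nat.cast_add, Nat.cast_one]
    ring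

/-- The reference simplex scaled by `s`. -/
def scaledSimplex (d : ℕ) (s : ℝ) : Set (Fin d → ℝ) :=
  {r | (∀ i, -1 ≤ r i) ∧ ∑ i, (1 + r i) / 2 ≤ s}

lemma isClosed_scaledSimplex (d : ℕ) (s : ℝ) : IsClosed (scaledSimplex d s) := by
  have h : scaledSimplex d s = (⋂ i, {r | -1 ≤ r i}) ∩ {r | ∑ i, (1 + r i) / 2 ≤ s} := by
    ext r; simp [scaledSimplex]
  rw [h]
  refine IsClosed.inter (isClosed_iInter fun i => isClosed_le (by fun_prop) (by fun_prop)) ?_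
  exact isClosed_le (by fun_prop) (by fun_prop)

lemma isCompact_scaledSimplex (d : ℕ) (s : ℝ) : IsCompact (scaledSimplex d s) := by
  refine IsCompact.of_isClosed_subset
    (isCompact_univ_pi (s := fun _ : Fin d => Set.Icc (-1) (2 * s - 1))
      fun _ => isCompact_Icc) (isClosed_scaledSimplex d s) ?_
  intro r hr i _
  refine ⟨hr.1 i, ?_⟩
  have := Finset.single_le_sum (f := fun i => (1 + r i) / 2)
    (fun j _ => by have := hr.1 j; linarith) (Finset.mem_univ i)
  have h2 := hr.2
  linarith

lemma cons_mem_scaledSimplex {d : ℕ} {s x : ℝ} {r : Fin d → ℝ} :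
    (Fin.cons x r : Fin (d + 1) → ℝ) ∈ scaledSimplex (d + 1) s ↔
      -1 ≤ x ∧ r ∈ scaledSimplex d (s - (1 + x) / 2) := by
  simp only [scaledSimplex, Set.mem_ofPred_eq, Fin.forall_fin_succ, Fin.cons_zero, Fin.cons_succ,
    Fin.sum_univ_succ, and_assoc, le_sub_iff_add_le']

lemma scaledSimplex_eq_empty {d : ℕ} {s : ℝ} (hs : s < 0) : scaledSimplex d s = ∅ := by
  ext r
  simp only [Set.mem_empty_iff_false, iff_false]
  intro hr
  have : 0 ≤ ∑ i, (1 + r i) / 2 := Finset.sum_nonneg fun i _ => by have := hr.1 i; linarith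
  linarith [hr.2]

/-- The Dirichlet integral over the scaled simplex. -/
theorem integral_scaledSimplex : ∀ (d : ℕ) (a : Fin d → ℕ) (c : ℕ) (s : ℝ), 0 ≤ s →
    ∫ r in scaledSimplex d s, (∏ i, ((1 + r i) / 2) ^ a i) * (s - ∑ i, (1 + r i) / 2) ^ c =
      2 ^ d * ((∏ i, ((a i).factorial : ℝ)) * c.factorial) / (∑ i, a i + c + d).factorial *
        s ^ (∑ i, a i + c + d) := by
  intro d
  induction d with
  | zero =>
    intro a c s hs
    have h : scaledSimplex 0 s = Set.univ := by
      ext r; simp [scaledSimplex, hs]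
    have hc : (c.factorial : ℝ) ≠ 0 := by positivity
    rw [h, Measure.restrict_univ, volume_pi, Measure.pi_of_empty, integral_dirac]
    simp [hc]
  | succ d ih =>
    intro a c s hs
    set F : (Fin (d + 1) → ℝ) → ℝ := fun r =>
      (∏ i, ((1 + r i) / 2) ^ a i) * (s - ∑ i, (1 + r i) / 2) ^ c with hF
    have hFc : Continuous F := by fun_prop
    have hmeas := (isClosed_scaledSimplex (d + 1) s).measurableSet
    have hint : Integrable ((scaledSimplex (d + 1) s).indicator F) :=
      (integrable_indicator_iff hmeas).mpr
        (hFc.continuousOn.integrableOn_compact (isCompact_scaledSimplex _ _))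
    have mp := (volume_preserving_piFinSuccAbove (fun _ : Fin (d + 1) => ℝ) 0).symm
    have hint2 := (mp.integrable_comp_emb (MeasurableEquiv.measurableEmbedding _)).mpr hint
    -- The slice at first coordinate `x` is the `d`-dimensional simplex of size `s - (1+x)/2`; it is
    -- empty unless `-1 ≤ x ≤ 2s-1`.
    have key : ∀ x : ℝ, ∫ r : Fin d → ℝ, (scaledSimplex (d + 1) s).indicator F (Fin.cons x r) =
        (Set.Icc (-1) (2 * s - 1)).indicator (fun x => ((1 + x) / 2) ^ a 0 *
          (2 ^ d * ((∏ i : Fin d, ((a i.succ).factorial : ℝ)) * c.factorial) /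
            (∑ i : Fin d, a i.succ + c + d).factorial *
            (s - (1 + x) / 2) ^ (∑ i : Fin d, a i.succ + c + d))) x := by
      intro x
      by_cases hx : x ∈ Set.Icc (-1) (2 * s - 1)
      · rw [Set.indicator_of_mem hx, ← ih (fun i => a i.succ) c (s - (1 + x) / 2)
          (by linarith [hx.2]), ← integral_const_mul,
          ← integral_indicator (isClosed_scaledSimplex d _).measurableSet]
        refine integral_congr_ae (Filter.Eventually.of_forall fun r => ?_)
        by_cases hr : r ∈ scaledSimplex d (s - (1 + x) / 2)
        · simp only
          rw [Set.indicator_of_mem hr, Set.indicator_of_mem (cons_mem_scaledSimplex.mpr ⟨hx.1, hr⟩)]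
          simp only [hF, Fin.prod_univ_succ, Fin.sum_univ_succ, Fin.cons_zero, Fin.cons_succ]
          ring
        · simp only
          rw [Set.indicator_of_notMem hr, Set.indicator_of_notMem
            (fun h => hr (cons_mem_scaledSimplex.mp h).2)]
      · rw [Set.indicator_of_notMem hx]
        refine integral_eq_zero_of_ae (Filter.Eventually.of_forall fun r => ?_)
        refine Set.indicator_of_notMem (fun h => hx ?_) _
        obtain ⟨h1, h2⟩ := cons_mem_scaledSimplex.mp h
        refine ⟨h1, ?_⟩
        by_contra h3
        rw [scaledSimplex_eq_empty (by push Not at h3; linarith)] at h2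
        exact h2
    rw [← integral_indicator hmeas, ← mp.integral_comp (MeasurableEquiv.measurableEmbedding _)]
    change ∫ z, ((scaledSimplex (d + 1) s).indicator F ∘
      (MeasurableEquiv.piFinSuccAbove (fun _ : Fin (d + 1) => ℝ) 0).symm) z = _
    have hcons : ∀ z : ℝ × (Fin d → ℝ),
        (MeasurableEquiv.piFinSuccAbove (fun _ : Fin (d + 1) => ℝ) 0).symm z = Fin.cons z.1 z.2 := by
      intro z
      rw [MeasurableEquiv.piFinSuccAbove_symm_apply]
      simp [Fin.insertNthEquiv]
    rw [Measure.volume_eq_prod] at hint2 ⊢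
    rw [integral_prod _ hint2]
    simp only [Function.comp_apply, hcons, key]
    rw [integral_indicator measurableSet_Icc, integral_Icc_eq_integral_Ioc,
      ← intervalIntegral.integral_of_le (by linarith)]
    -- The substitution `x = 2t - 1` turns the outer integral into a beta integral on `[0, s]`; its
    -- Jacobian adds one factor `2`.
    have hsub := intervalIntegral.mul_integral_comp_mul_sub (a := 0) (b := s)
      (f := fun x : ℝ => ((1 + x) / 2) ^ a 0 *
          (2 ^ d * ((∏ i : Fin d, ((a i.succ).factorial : ℝ)) * c.factorial) /
            (∑ i : Fin d, a i.succ + c + d).factorial *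
            (s - (1 + x) / 2) ^ (∑ i : Fin d, a i.succ + c + d))) 2 1
    rw [mul_zero, zero_sub] at hsub
    rw [← hsub]
    have hbeta := integral_pow_mul_sub_pow s (a 0) (∑ i : Fin d, a i.succ + c + d)
    have e : ∀ x : ℝ, (1 + (2 * x - 1)) / 2 = x := fun x => by ring
    simp only [e]
    simp only [mul_left_comm (_ ^ a 0 : ℝ), intervalIntegral.integral_const_mul]
    rw [hbeta, Fin.prod_univ_succ, Fin.sum_univ_succ,
      show a 0 + (∑ i : Fin d, a i.succ + c + d) + 1 =
        a 0 + ∑ i : Fin d, a i.succ + c + (d + 1) by ring]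
    have h1 : ((∑ i : Fin d, a i.succ + c + d).factorial : ℝ) ≠ 0 := by positivity
    field_simp
    ring

lemma refSimplex_eq (d : ℕ) : refSimplex d = scaledSimplex d 1 := rfl

lemma eval_bary_zero {d : ℕ} (r : Fin d → ℝ) :
    MvPolynomial.eval r (bary d 0) = 1 - ∑ i, (1 + r i) / 2 := by
  simp only [bary, Fin.cons_zero, map_sub, map_one, map_sum, map_mul, map_add, MvPolynomial.eval_C,
    MvPolynomial.eval_X]
  congr 1
  exact Finset.sum_congr rfl fun i _ => by ring

lemma eval_bary_succ {d : ℕ} (r : Fin d → ℝ) (i : Fin d) :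
    MvPolynomial.eval r (bary d i.succ) = (1 + r i) / 2 := by
  simp only [bary, Fin.cons_succ, map_mul, map_add, map_one, MvPolynomial.eval_C,
    MvPolynomial.eval_X]
  ring

/-- The integral of a monomial in the barycentric coordinates. -/
theorem integral_bary_pow {d : ℕ} (α : Fin (d + 1) → ℕ) :
    ∫ r in refSimplex d, MvPolynomial.eval r (∏ j, bary d j ^ α j) =
      2 ^ d * (∏ j, ((α j).factorial : ℝ)) / (∑ j, α j + d).factorial := by
  have h := integral_scaledSimplex d (fun i => α i.succ) (α 0) 1 zero_le_one
  rw [one_pow, mul_one] at h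
  rw [Fin.prod_univ_succ (fun j => ((α j).factorial : ℝ)), Fin.sum_univ_succ,
    mul_comm ((α 0).factorial : ℝ), add_comm (α 0), ← h, refSimplex_eq]
  congr 1
  funext r
  rw [map_prod, Fin.prod_univ_succ]
  simp only [map_pow, eval_bary_zero, eval_bary_succ]
  ring

/-! ### The `L²` form and its definiteness -/

lemma integrableOn_eval {d : ℕ} (p : MvPolynomial (Fin d) ℝ) :
    IntegrableOn (fun r => MvPolynomial.eval r p) (refSimplex d) :=
  (MvPolynomial.continuous_eval p).continuousOn.integrableOn_compact (isCompact_scaledSimplex d 1)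

lemma l2_eq_integral {d : ℕ} (p q : MvPolynomial (Fin d) ℝ) :
    l2 p q = ∫ r in refSimplex d, MvPolynomial.eval r (p * q) := by
  simp only [l2, map_mul]

/-- The `L²` inner product as a bilinear form. -/
def l2Form (d : ℕ) : MvPolynomial (Fin d) ℝ →ₗ[ℝ] MvPolynomial (Fin d) ℝ →ₗ[ℝ] ℝ :=
  LinearMap.mk₂ ℝ l2
    (fun p q s => by
      simp only [l2_eq_integral, add_mul, map_add]
      exact integral_add (integrableOn_eval _) (integrableOn_eval _))
    (fun c p q => by
      simp only [l2_eq_integral, smul_mul_assoc, MvPolynomial.smul_eval, smul_eq_mul]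
      exact integral_const_mul _ _)
    (fun p q s => by
      simp only [l2_eq_integral, mul_add, map_add]
      exact integral_add (integrableOn_eval _) (integrableOn_eval _))
    (fun c p q => by
      simp only [l2_eq_integral, mul_smul_comm, MvPolynomial.smul_eval, smul_eq_mul]
      exact integral_const_mul _ _)

@[simp]
lemma l2Form_apply {d : ℕ} (p q : MvPolynomial (Fin d) ℝ) : l2Form d p q = l2 p q := rfl

lemma l2_comm {d : ℕ} (p q : MvPolynomial (Fin d) ℝ) : l2 p q = l2 q p := by
  simp only [l2_eq_integral, mul_comm]

/-- The square of `p` vanishes almost everywhere on the simplex, hence by continuity on an open cube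
inside it. A cube is a product of infinite sets, which forces the polynomial to be zero. -/
lemma eq_zero_of_l2_self_eq_zero {d : ℕ} {p : MvPolynomial (Fin d) ℝ} (h : l2 p p = 0) :
    p = 0 := by
  have hc : Continuous fun r => MvPolynomial.eval r p * MvPolynomial.eval r p :=
    (MvPolynomial.continuous_eval p).mul (MvPolynomial.continuous_eval p)
  have hi : IntegrableOn (fun r => MvPolynomial.eval r p * MvPolynomial.eval r p) (refSimplex d) :=
    hc.continuousOn.integrableOn_compact (isCompact_scaledSimplex d 1)
  have hae := (integral_eq_zero_iff_of_nonneg (fun r => mul_self_nonneg _) hi).mp h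
  -- This side length keeps each `(1 + r_i)/2` below `1/(d+1)`, so the `d` terms sum to at most `1`.
  set s : Set ℝ := Set.Ioo (-1) (-1 + 2 / (d + 1)) with hs
  have hd : (0 : ℝ) < 2 / (d + 1) := by positivity
  have hsub : Set.univ.pi (fun _ : Fin d => s) ⊆ refSimplex d := by
    intro r hr
    refine ⟨fun i => (hr i trivial).1.le, ?_⟩
    calc ∑ i, (1 + r i) / 2 ≤ ∑ _i : Fin d, (1 / (d + 1) : ℝ) := by
          refine Finset.sum_le_sum fun i _ => ?_
          have := (hr i trivial).2
          have e : (2 / (d + 1) : ℝ) = 2 * (1 / (d + 1)) := by ring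
          linarith
      _ ≤ 1 := by
          rw [Finset.sum_const, Finset.card_univ, Fintype.card_fin, nsmul_eq_mul, mul_one_div,
            div_le_one (by positivity)]
          linarith
  have hopen : IsOpen (Set.univ.pi (fun _ : Fin d => s)) :=
    isOpen_set_pi Set.finite_univ fun _ _ => isOpen_Ioo
  have hae2 := ae_restrict_of_ae_restrict_of_subset hsub hae
  have heq := Measure.eqOn_open_of_ae_eq hae2 hopen hc.continuousOn continuousOn_const
  refine MvPolynomial.funext_set (fun _ => s) (fun _ => Set.Ioo_infinite (by linarith)) fun x hx => ?_
  rw [map_zero]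
  exact mul_self_eq_zero.mp (heq hx)

/-! ### Bernstein moments and factorial-weighted sums -/

/-- A monomial in the barycentric coordinates. -/
def baryPow {d : ℕ} (κ : Fin (d + 1) → ℕ) : MvPolynomial (Fin d) ℝ := ∏ j, bary d j ^ κ j

lemma baryPow_add {d : ℕ} (κ μ : Fin (d + 1) → ℕ) :
    baryPow (κ + μ) = baryPow κ * baryPow μ := by
  simp only [baryPow, Pi.add_apply, pow_add, Finset.prod_mul_distrib]

lemma bern_eq {d : ℕ} (α : Fin (d + 1) → ℕ) :
    bern α = (((∑ j, α j).factorial : ℝ) / (∏ j, ((α j).factorial : ℝ))) • baryPow α := by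
  rw [bern, MvPolynomial.smul_eq_C_mul, baryPow]

lemma l2_bern_baryPow {d n : ℕ} (α : BernIdx d n) (μ : Fin (d + 1) → ℕ) :
    l2 (bern α.1) (baryPow μ) = 2 ^ d * n.factorial / (n + ∑ j, μ j + d).factorial *
      ∏ j, ((α.1 j + 1).ascFactorial (μ j) : ℝ) := by
  have h := integral_bary_pow (α.1 + μ)
  change ∫ r in refSimplex d, MvPolynomial.eval r (baryPow (α.1 + μ)) = _ at h
  rw [baryPow_add, ← l2_eq_integral] at h
  rw [bern_eq, ← l2Form_apply, map_smul, LinearMap.smul_apply, l2Form_apply, h]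
  simp only [Pi.add_apply, Finset.sum_add_distrib, α.2, ← Nat.factorial_mul_ascFactorial,
    Nat.cast_mul, Finset.prod_mul_distrib, smul_eq_mul]
  have h1 : (∏ j, ((α.1 j).factorial : ℝ)) ≠ 0 := by positivity
  field_simp

lemma sum_bern (d m : ℕ) : ∑ β : BernIdx d m, bern β.1 = 1 := by
  have h := Finset.sum_pow_eq_sum_piAntidiag (Finset.univ : Finset (Fin (d + 1))) (bary d) m
  rw [sum_bary, one_pow, Finset.sum_subtype (p := fun α => ∑ j, α j = m) _ (fun x => by simp)] at h
  rw [h]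
  refine Finset.sum_congr rfl fun β _ => ?_
  rw [bern]
  congr 1
  have h1 : (∏ j, ((β.1 j).factorial : ℝ)) ≠ 0 := by positivity
  have h2 := Nat.multinomial_spec (Finset.univ : Finset (Fin (d + 1))) β.1
  rw [← h2, Nat.cast_mul, Nat.cast_prod, mul_div_cancel_left₀ _ h1, map_natCast]

/-- Terms with some `α_j < κ_j` vanish. In the others `α = β + κ`, and the falling factorials cancel
against the multinomial coefficient, leaving `b^κ` times a partition of unity in the `B_β`. If `|κ|
> n` both sides are zero. -/
lemma sum_descFactorial_smul_bern (d n : ℕ) (κ : Fin (d + 1) → ℕ) :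
    ∑ α : BernIdx d n, (∏ j, ((α.1 j).descFactorial (κ j) : ℝ)) • bern α.1 =
      (n.descFactorial (∑ j, κ j) : ℝ) • baryPow κ := by
  by_cases hκ : ∑ j, κ j ≤ n
  · obtain ⟨m, rfl⟩ := Nat.exists_eq_add_of_le' hκ
    let e : BernIdx d m → BernIdx d (m + ∑ j, κ j) := fun β =>
      ⟨β.1 + κ, by simp [Finset.sum_add_distrib, β.2]⟩
    have he : Function.Injective e := fun β β' h =>
      Subtype.ext (add_right_cancel (congrArg Subtype.val h))
    rw [← Fintype.sum_of_injective e he (fun β => ((m + ∑ j, κ j).descFactorial (∑ j, κ j) : ℝ) •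
      (bern β.1 * baryPow κ)), ← Finset.smul_sum, ← Finset.sum_mul, sum_bern, one_mul]
    · intro α hα
      have : ∃ j, α.1 j < κ j := by
        by_contra! hle
        refine hα ⟨⟨α.1 - κ, ?_⟩, ?_⟩
        · have h1 := α.2
          have h2 : ∑ j, (α.1 - κ) j + ∑ j, κ j = ∑ j, α.1 j := by
            rw [← Finset.sum_add_distrib]
            exact Finset.sum_congr rfl fun j _ => Nat.sub_add_cancel (hle j)
          omega
        · exact Subtype.ext (tsub_add_cancel_of_le hle)
      obtain ⟨j, hj⟩ := this
      rw [Finset.prod_eq_zero (Finset.mem_univ j), zero_smul]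
      exact_mod_cast Nat.descFactorial_eq_zero_iff_lt.mpr hj
    · intro β
      rw [bern_eq, bern_eq, smul_mul_assoc, ← baryPow_add, smul_smul, smul_smul]
      congr 1
      have h1 : ∀ a k : ℕ, ((a + k).descFactorial k : ℝ) = (a + k).factorial / a.factorial := by
        intro a k
        have h := Nat.factorial_mul_descFactorial (Nat.le_add_left k a)
        rw [Nat.add_sub_cancel] at h
        rw [← h, Nat.cast_mul, mul_div_cancel_left₀]
        positivity
      have h2 : (∏ j, ((β.1 j).factorial : ℝ)) ≠ 0 := by positivity
      have h3 : (∏ j, ((β.1 j + κ j).factorial : ℝ)) ≠ 0 := by positivity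
      have h4 : (m.factorial : ℝ) ≠ 0 := by positivity
      simp only [e, Pi.add_apply, h1, Finset.prod_div_distrib, Finset.sum_add_distrib, β.2]
      field_simp
  · rw [Nat.descFactorial_eq_zero_iff_lt.mpr (not_le.mp hκ), Nat.cast_zero, zero_smul]
    refine Finset.sum_eq_zero fun α _ => ?_
    have : ∃ j, α.1 j < κ j := by
      by_contra! hle
      exact hκ ((Finset.sum_le_sum fun j _ => hle j).trans_eq α.2)
    obtain ⟨j, hj⟩ := this
    rw [Finset.prod_eq_zero (Finset.mem_univ j), zero_smul]
    exact_mod_cast Nat.descFactorial_eq_zero_iff_lt.mpr hj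

/-- Vandermonde's identity: the expansion of rising factorials into falling factorials. -/
lemma ascFactorial_eq_sum_descFactorial : ∃ c : ℕ → ℕ → ℝ, (∀ m, c m m = 1) ∧
    ∀ a m : ℕ, ((a + 1).ascFactorial m : ℝ) =
      ∑ l ∈ Finset.range (m + 1), c m l * (a.descFactorial l : ℝ) := by
  -- Read off from `C(a+m, m) = ∑ C(a, l) C(m, m-l)` after multiplying by `m!`.
  refine ⟨fun m l => m.factorial * m.choose (m - l) / l.factorial, fun m => ?_, fun a m => ?_⟩
  · have : (m.factorial : ℝ) ≠ 0 := by positivity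
    simp [this]
  · rw [Nat.ascFactorial_eq_factorial_mul_choose, Nat.add_choose_eq,
      Finset.Nat.sum_antidiagonal_eq_sum_range_succ (fun i j => a.choose i * m.choose j)]
    push_cast
    rw [Finset.mul_sum]
    refine Finset.sum_congr rfl fun l _ => ?_
    rw [Nat.descFactorial_eq_factorial_mul_choose]
    have : (l.factorial : ℝ) ≠ 0 := by positivity
    push_cast
    field_simp

/-! ### The Bernstein–Durrmeyer operator: symmetry and triangularity -/

/-- The Bernstein–Durrmeyer operator `p ↦ ∑ ⟨B_α, p⟩ B_α`. -/
def durrmeyer (d n : ℕ) : MvPolynomial (Fin d) ℝ →ₗ[ℝ] MvPolynomial (Fin d) ℝ :=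
  ∑ α : BernIdx d n, (l2Form d (bern α.1)).smulRight (bern α.1)

lemma durrmeyer_apply {d n : ℕ} (p : MvPolynomial (Fin d) ℝ) :
    durrmeyer d n p = ∑ α : BernIdx d n, l2 (bern α.1) p • bern α.1 := by
  simp [durrmeyer]

lemma l2_durrmeyer {d n : ℕ} (p q : MvPolynomial (Fin d) ℝ) :
    l2 (durrmeyer d n p) q = l2 p (durrmeyer d n q) := by
  rw [← l2Form_apply, ← l2Form_apply, durrmeyer_apply, durrmeyer_apply]
  simp only [map_sum, map_smul, LinearMap.sum_apply, LinearMap.smul_apply, l2Form_apply,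
    smul_eq_mul]
  exact Finset.sum_congr rfl fun α _ => by rw [l2_comm p, mul_comm]

/-- The eigenvalues of the Bernstein–Durrmeyer operator. -/
def durrmeyerEig (d n k : ℕ) : ℝ :=
  2 ^ d * n.factorial * n.descFactorial k / (n + k + d).factorial

lemma durrmeyerEig_pos {d n k : ℕ} (hk : k ≤ n) : 0 < durrmeyerEig d n k := by
  have : 0 < n.descFactorial k := Nat.descFactorial_pos.mpr hk
  unfold durrmeyerEig
  positivity

/-- The ratio of consecutive values is `(n-k)/(n+k+d+1) < 1`. -/
lemma durrmeyerEig_succ_lt {d n k : ℕ} (hk : k ≤ n) :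
    durrmeyerEig d n (k + 1) < durrmeyerEig d n k := by
  have h0 : (0 : ℝ) < n.descFactorial k := by exact_mod_cast Nat.descFactorial_pos.mpr hk
  have h1 : ((n - k : ℕ) : ℝ) < ((n + k + d + 1 : ℕ) : ℝ) := by
    exact_mod_cast (by omega)
  have e : n + (k + 1) + d = n + k + d + 1 := by ring
  rw [durrmeyerEig, durrmeyerEig, e, Nat.factorial_succ, Nat.descFactorial_succ, Nat.cast_mul,
    Nat.cast_mul, div_lt_div_iff₀ (by positivity) (by positivity)]
  have h2 : (0 : ℝ) < 2 ^ d * n.factorial * n.descFactorial k * (n + k + d).factorial := by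
    positivity
  nlinarith [mul_lt_mul_of_pos_left h1 h2]

lemma durrmeyerEig_strictAntiOn (d n : ℕ) : StrictAntiOn (durrmeyerEig d n) (Set.Iic n) := by
  intro a _ b hb hab
  induction b, hab using Nat.le_induction with
  | base => exact durrmeyerEig_succ_lt (by have := Set.mem_Iic.mp hb; omega)
  | succ b hab ih =>
    have hb' : b + 1 ≤ n := hb
    exact (durrmeyerEig_succ_lt (by omega)).trans (ih (Set.mem_Iic.mpr (by omega)))

/-- The polynomials of total degree less than `k`. -/
def lowSpan (d k : ℕ) : Submodule ℝ (MvPolynomial (Fin d) ℝ) :=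
  Submodule.span ℝ {p | ∃ κ : Fin (d + 1) → ℕ, ∑ j, κ j < k ∧ p = baryPow κ}

lemma lowSpan_mono {d k l : ℕ} (h : k ≤ l) : lowSpan d k ≤ lowSpan d l :=
  Submodule.span_mono fun _ ⟨κ, hκ, e⟩ => ⟨κ, hκ.trans_le h, e⟩

lemma baryPow_mem_lowSpan {d k : ℕ} {κ : Fin (d + 1) → ℕ} (h : ∑ j, κ j < k) :
    baryPow κ ∈ lowSpan d k := Submodule.subset_span ⟨κ, h, rfl⟩

lemma totalDegree_baryPow_le {d : ℕ} (κ : Fin (d + 1) → ℕ) :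
    (baryPow κ).totalDegree ≤ ∑ j, κ j := by
  refine (MvPolynomial.totalDegree_finsetProd _ _).trans (Finset.sum_le_sum fun j _ => ?_)
  refine (MvPolynomial.totalDegree_pow _ _).trans ?_
  simpa using Nat.mul_le_mul_left (κ j) (totalDegree_bary_le d j)

lemma P_le_lowSpan (d k : ℕ) : P d k ≤ lowSpan d (k + 1) := by
  refine (P_le_bernSpan d k).trans (Submodule.span_le.mpr ?_)
  rintro _ ⟨α, rfl⟩
  simp only [bern_eq]
  exact Submodule.smul_mem _ _ (baryPow_mem_lowSpan (by rw [α.2]; exact Nat.lt_succ_self k))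

/-- The expansion into falling factorials involves only `κ ≤ μ` componentwise, so every term except
`κ = μ` has smaller total degree. The diagonal term carries the eigenvalue because `c m m = 1`. -/
theorem durrmeyer_baryPow_sub_mem {d n : ℕ} (μ : Fin (d + 1) → ℕ) :
    durrmeyer d n (baryPow μ) - durrmeyerEig d n (∑ j, μ j) • baryPow μ ∈
      lowSpan d (∑ j, μ j) := by
  obtain ⟨c, hc1, hc⟩ := ascFactorial_eq_sum_descFactorial
  set A : ℝ := 2 ^ d * n.factorial / (n + ∑ j, μ j + d).factorial with hA
  have h : durrmeyer d n (baryPow μ) =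
      ∑ κ ∈ Fintype.piFinset fun j => Finset.range (μ j + 1),
        (A * (∏ j, c (μ j) (κ j)) * n.descFactorial (∑ j, κ j)) • baryPow κ := by
    rw [durrmeyer_apply]
    simp only [l2_bern_baryPow, hc, Finset.prod_univ_sum, ← hA, Finset.mul_sum, Finset.sum_smul]
    rw [Finset.sum_comm]
    refine Finset.sum_congr rfl fun κ _ => ?_
    rw [mul_smul, ← sum_descFactorial_smul_bern, Finset.smul_sum]
    refine Finset.sum_congr rfl fun α _ => ?_
    rw [smul_smul, Finset.prod_mul_distrib, mul_assoc]
  have hμ : μ ∈ Fintype.piFinset fun j => Finset.range (μ j + 1) := by simp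
  rw [h, ← Finset.add_sum_erase _ _ hμ]
  have e : A * (∏ j, c (μ j) (μ j)) * n.descFactorial (∑ j, μ j) =
      durrmeyerEig d n (∑ j, μ j) := by
    simp only [hc1, Finset.prod_const_one, hA, durrmeyerEig]
    ring
  rw [e, add_sub_cancel_left]
  refine Submodule.sum_mem _ fun κ hκ => Submodule.smul_mem _ _ (baryPow_mem_lowSpan ?_)
  obtain ⟨hne, hle⟩ := Finset.mem_erase.mp hκ
  have hle' : ∀ j, κ j ≤ μ j := fun j =>
    Nat.lt_succ_iff.mp (Finset.mem_range.mp (Fintype.mem_piFinset.mp hle j))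
  obtain ⟨j, hj⟩ := Function.ne_iff.mp hne
  exact Finset.sum_lt_sum (fun j _ => hle' j) ⟨j, Finset.mem_univ j, lt_of_le_of_ne (hle' j) hj⟩

/-- Any `p ∈ P^k` is a combination of `b^α` with `|α|` exactly `k`, so a single diagonal entry
serves all its terms. -/
lemma durrmeyer_sub_mem {d n k : ℕ} {p : MvPolynomial (Fin d) ℝ} (hp : p ∈ P d k) :
    durrmeyer d n p - durrmeyerEig d n k • p ∈ lowSpan d k := by
  suffices h : bernSpan d k ≤ (lowSpan d k).comap
      (durrmeyer d n - durrmeyerEig d n k • LinearMap.id) from h (P_le_bernSpan d k hp)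
  refine Submodule.span_le.mpr ?_
  rintro _ ⟨α, rfl⟩
  simp only [bern_eq]
  refine Submodule.smul_mem _ _ ?_
  have h := durrmeyer_baryPow_sub_mem (n := n) α.1
  rw [α.2] at h
  exact h

lemma durrmeyer_mem_lowSpan {d n k : ℕ} {p : MvPolynomial (Fin d) ℝ} (hp : p ∈ lowSpan d k) :
    durrmeyer d n p ∈ lowSpan d k := by
  suffices h : lowSpan d k ≤ (lowSpan d k).comap (durrmeyer d n) from h hp
  refine Submodule.span_le.mpr ?_
  rintro _ ⟨κ, hκ, rfl⟩
  have h := lowSpan_mono hκ.le (durrmeyer_baryPow_sub_mem (n := n) κ)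
  exact (Submodule.sub_mem_iff_left _
    (Submodule.smul_mem _ _ (baryPow_mem_lowSpan hκ))).mp h

lemma mem_lowSpan_of_totalDegree_lt {d k : ℕ} {q : MvPolynomial (Fin d) ℝ}
    (hq : q.totalDegree < k) : q ∈ lowSpan d k :=
  lowSpan_mono hq (P_le_lowSpan d q.totalDegree
    ((MvPolynomial.mem_restrictTotalDegree _ _ _).mpr le_rfl))

lemma orthogonal_lowSpan_iff {d k : ℕ} {p : MvPolynomial (Fin d) ℝ} :
    (∀ q : MvPolynomial (Fin d) ℝ, q.totalDegree < k → l2 p q = 0) ↔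
      ∀ q ∈ lowSpan d k, l2 p q = 0 := by
  refine ⟨fun h => ?_, fun h q hq => h q (mem_lowSpan_of_totalDegree_lt hq)⟩
  suffices h' : lowSpan d k ≤ LinearMap.ker (l2Form d p) from fun q hq => h' hq
  refine Submodule.span_le.mpr ?_
  rintro _ ⟨κ, hκ, rfl⟩
  exact h _ ((totalDegree_baryPow_le κ).trans_lt hκ)

/-- Polynomials of degree `k` orthogonal to all lower degrees are eigenvectors. -/
theorem durrmeyer_eq_smul {d n k : ℕ} {p : MvPolynomial (Fin d) ℝ} (hp : p ∈ P d k)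
    (ho : ∀ q ∈ lowSpan d k, l2 p q = 0) : durrmeyer d n p = durrmeyerEig d n k • p := by
  have hr := durrmeyer_sub_mem (n := n) hp
  refine sub_eq_zero.mp (eq_zero_of_l2_self_eq_zero ?_)
  set r := durrmeyer d n p - durrmeyerEig d n k • p with hrd
  have h : l2 r r = l2 (durrmeyer d n p) r - durrmeyerEig d n k * l2 p r := by
    conv_lhs => rw [← l2Form_apply]; arg 1; rw [hrd]
    simp
  -- The residual `r` and its image both have degree below `k`, and `p` is orthogonal to both;
  -- symmetry moves the operator onto `r`.
  rw [h, l2_durrmeyer, ho _ (durrmeyer_mem_lowSpan hr), ho _ hr, mul_zero, sub_zero]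

/-! ### Diagonalization in the modal basis -/

section Modal

variable {d : ℕ} {L : (Fin d → ℕ) → MvPolynomial (Fin d) ℝ} (hL : IsModalBasis L)
include hL

lemma IsModalBasis.eq_sum {n : ℕ} {p : MvPolynomial (Fin d) ℝ} (hp : p ∈ P d n) :
    p = ∑ γ : ModalIdx d n, (modalBasis hL n).repr ⟨p, hp⟩ γ • L γ.1 := by
  have h := congrArg (P d n).subtype ((modalBasis hL n).sum_repr ⟨p, hp⟩)
  simp only [map_sum, map_smul, Submodule.subtype_apply, modalBasis_apply] at h
  exact h.symm

/-- A polynomial of degree below `|γ|` expands in the `L_ν` with `|ν| < |γ|` alone, all orthogonal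
to `L_γ`. -/
lemma IsModalBasis.l2_eq_zero (γ : Fin d → ℕ) :
    ∀ q ∈ lowSpan d (∑ j, γ j), l2 (L γ) q = 0 := by
  refine orthogonal_lowSpan_iff.mp fun q hq => ?_
  rw [hL.eq_sum ((MvPolynomial.mem_restrictTotalDegree _ _ _).mpr (le_refl q.totalDegree)),
    ← l2Form_apply, map_sum]
  refine Finset.sum_eq_zero fun ν _ => ?_
  rw [map_smul, l2Form_apply, hL.orthogonal, smul_zero]
  rintro rfl
  exact absurd ν.2 (not_le.mpr hq)

lemma IsModalBasis.durrmeyer_eq (n : ℕ) (γ : Fin d → ℕ) :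
    durrmeyer d n (L γ) = durrmeyerEig d n (∑ j, γ j) • L γ :=
  durrmeyer_eq_smul (hL.mem _ γ le_rfl) (hL.l2_eq_zero γ)

lemma IsModalBasis.repr_mul_eq {n : ℕ} {p : MvPolynomial (Fin d) ℝ} (hp : p ∈ P d n) {x : ℝ}
    (h : durrmeyer d n p = x • p) (γ : ModalIdx d n) :
    (modalBasis hL n).repr ⟨p, hp⟩ γ * (durrmeyerEig d n (∑ j, γ.1 j) - x) = 0 := by
  set a := (modalBasis hL n).repr ⟨p, hp⟩ with ha
  have hli := hL.linearIndependent.comp (fun γ : ModalIdx d n => γ.1) Subtype.val_injective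
  refine Fintype.linearIndependent_iff.mp hli
    (fun γ => a γ * (durrmeyerEig d n (∑ j, γ.1 j) - x)) ?_ γ
  have hs := hL.eq_sum hp
  rw [← ha] at hs
  rw [hs, map_sum, Finset.smul_sum, ← sub_eq_zero, ← Finset.sum_sub_distrib] at h
  rw [← h]
  refine Finset.sum_congr rfl fun ν _ => ?_
  rw [map_smul, hL.durrmeyer_eq, smul_smul, smul_smul, ← sub_smul, Function.comp_apply]
  congr 1
  ring

/-- Since the eigenvalues are distinct on `k ≤ n`, an eigenvector has modal components only at `|γ|
= k`. -/
theorem IsModalBasis.durrmeyer_eq_smul_iff {n k : ℕ} (hk : k ≤ n) {p : MvPolynomial (Fin d) ℝ}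
    (hp : p ∈ P d n) : durrmeyer d n p = durrmeyerEig d n k • p ↔
      p ∈ P d k ∧ ∀ q : MvPolynomial (Fin d) ℝ, q.totalDegree < k → l2 p q = 0 := by
  rw [orthogonal_lowSpan_iff]
  refine ⟨fun h => ?_, fun h => durrmeyer_eq_smul h.1 h.2⟩
  have ha : ∀ γ : ModalIdx d n, ∑ j, γ.1 j ≠ k → (modalBasis hL n).repr ⟨p, hp⟩ γ = 0 := by
    intro γ hγ
    refine (mul_eq_zero.mp (hL.repr_mul_eq hp h γ)).resolve_right fun h0 => hγ ?_
    exact (durrmeyerEig_strictAntiOn d n).injOn γ.2 hk (sub_eq_zero.mp h0)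
  have hs := hL.eq_sum hp
  set a := (modalBasis hL n).repr ⟨p, hp⟩
  constructor
  · rw [hs]
    refine Submodule.sum_mem _ fun γ _ => ?_
    by_cases hγ : ∑ j, γ.1 j = k
    · exact Submodule.smul_mem _ _ (hL.mem k γ.1 hγ.le)
    · rw [ha γ hγ, zero_smul]
      exact Submodule.zero_mem _
  · intro q hq
    rw [hs, ← l2Form_apply, map_sum, LinearMap.sum_apply]
    refine Finset.sum_eq_zero fun γ _ => ?_
    rw [map_smul, LinearMap.smul_apply, l2Form_apply]
    by_cases hγ : ∑ j, γ.1 j = k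
    · rw [hL.l2_eq_zero γ.1 q (hγ ▸ hq), smul_zero]
    · rw [ha γ hγ, zero_smul]

end Modal

/-! ### From the operator to the mass matrix and its sorted spectrum -/

lemma ofBernCoeff_eq {d n : ℕ} (c : BernIdx d n → ℝ) :
    ofBernCoeff c = ((bernBasis d n).equivFun.symm c : MvPolynomial (Fin d) ℝ) := by
  rw [Module.Basis.equivFun_symm_apply, ← Submodule.subtype_apply, map_sum]
  simp only [map_smul, Submodule.subtype_apply, bernBasis_apply, ofBernCoeff]

lemma ofBernCoeff_mem {d n : ℕ} (c : BernIdx d n → ℝ) : ofBernCoeff c ∈ P d n := by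
  rw [ofBernCoeff_eq]
  exact Subtype.prop _

lemma ofBernCoeff_injective {d n : ℕ} :
    Function.Injective (ofBernCoeff : (BernIdx d n → ℝ) → MvPolynomial (Fin d) ℝ) := by
  intro c c' h
  rw [ofBernCoeff_eq, ofBernCoeff_eq] at h
  exact (bernBasis d n).equivFun.symm.injective (Subtype.ext h)

lemma ofBernCoeff_smul {d n : ℕ} (x : ℝ) (c : BernIdx d n → ℝ) :
    ofBernCoeff (x • c) = x • ofBernCoeff c := by
  simp only [ofBernCoeff, Finset.smul_sum, Pi.smul_apply, smul_assoc]

lemma ofBernCoeff_repr {d n : ℕ} (p : P d n) :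
    ofBernCoeff (fun α => (bernBasis d n).repr p α) = (p : MvPolynomial (Fin d) ℝ) := by
  rw [ofBernCoeff_eq]
  exact congrArg Subtype.val ((bernBasis d n).equivFun.symm_apply_apply p)

lemma mass_mulVec_apply {d n : ℕ} (c : BernIdx d n → ℝ) (α : BernIdx d n) :
    (mass d n *ᵥ c) α = l2 (bern α.1) (ofBernCoeff c) := by
  rw [← l2Form_apply, ofBernCoeff, map_sum]
  simp only [map_smul, l2Form_apply, Matrix.mulVec, dotProduct, mass, Matrix.of_apply, smul_eq_mul,
    mul_comm]

lemma ofBernCoeff_mass_mulVec {d n : ℕ} (c : BernIdx d n → ℝ) :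
    ofBernCoeff (mass d n *ᵥ c) = durrmeyer d n (ofBernCoeff c) := by
  rw [durrmeyer_apply, ofBernCoeff]
  simp only [mass_mulVec_apply]

lemma mass_mulVec_eq_smul_iff {d n : ℕ} (c : BernIdx d n → ℝ) (x : ℝ) :
    mass d n *ᵥ c = x • c ↔ durrmeyer d n (ofBernCoeff c) = x • ofBernCoeff c := by
  rw [← ofBernCoeff_mass_mulVec, ← ofBernCoeff_smul, ofBernCoeff_injective.eq_iff]

theorem IsModalBasis.massEigenvalues_eq {d : ℕ} (hd : 0 < d)
    {L : (Fin d → ℕ) → MvPolynomial (Fin d) ℝ} (hL : IsModalBasis L) (n : ℕ) :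
    massEigenvalues d n = (Finset.range (n + 1)).image (durrmeyerEig d n) := by
  ext x
  rw [massEigenvalues, Set.Finite.mem_toFinset, Finset.mem_image]
  constructor
  · intro hx
    obtain ⟨c, hc⟩ := Module.End.HasEigenvalue.exists_hasEigenvector hx
    have hc1 := hc.apply_eq_smul
    rw [Matrix.toLin'_apply, mass_mulVec_eq_smul_iff] at hc1
    by_contra! hne
    refine hc.2 (ofBernCoeff_injective ?_)
    rw [hL.eq_sum (ofBernCoeff_mem c)]
    have h0 : ofBernCoeff (0 : BernIdx d n → ℝ) = 0 := by simp [ofBernCoeff]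
    rw [h0]
    refine Finset.sum_eq_zero fun γ _ => ?_
    rw [(mul_eq_zero.mp (hL.repr_mul_eq (ofBernCoeff_mem c) hc1 γ)).resolve_right
      (sub_ne_zero.mpr (hne _ (Finset.mem_range.mpr (Nat.lt_succ_iff.mpr γ.2)))), zero_smul]
  · rintro ⟨k, hk, rfl⟩
    have hk' : k ≤ n := Nat.lt_succ_iff.mp (Finset.mem_range.mp hk)
    -- Here `d > 0` is essential: each degree `k ≤ n` must be attained by some `L_γ`.
    let γ : Fin d → ℕ := Pi.single ⟨0, hd⟩ k
    have hγ : ∑ j, γ j = k := by simp [γ]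
    have hmem := hL.mem n γ (hγ.trans_le hk')
    have hr := ofBernCoeff_repr (⟨L γ, hmem⟩ : P d n)
    refine Module.End.hasEigenvalue_of_hasEigenvector
      (x := fun α => (bernBasis d n).repr ⟨L γ, hmem⟩ α) ⟨?_, fun h0 => ?_⟩
    · rw [Module.End.mem_eigenspace_iff, Matrix.toLin'_apply, mass_mulVec_eq_smul_iff, hr,
        hL.durrmeyer_eq, hγ]
    · rw [h0] at hr
      refine hL.linearIndependent.ne_zero γ ?_
      simpa [ofBernCoeff] using hr.symm

lemma sort_image_range_of_strictAntiOn {n : ℕ} {f : ℕ → ℝ} (hf : StrictAntiOn f (Set.Iic n)) :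
    ((Finset.range (n + 1)).image f).sort (· ≥ ·) = (List.range (n + 1)).map f := by
  have hinj : Set.InjOn f (Finset.range (n + 1)) := fun a ha b hb h =>
    hf.injOn (Nat.lt_succ_iff.mp (Finset.mem_range.mp ha))
      (Nat.lt_succ_iff.mp (Finset.mem_range.mp hb)) h
  refine List.Perm.eq_of_pairwise' (Finset.pairwise_sort _ _) ?_ ?_
  · rw [List.pairwise_map]
    refine List.pairwise_lt_range.imp_of_mem fun {a b} ha hb hab => ?_
    exact (hf (Nat.lt_succ_iff.mp (List.mem_range.mp ha))
      (Nat.lt_succ_iff.mp (List.mem_range.mp hb)) hab).le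
  · rw [← Multiset.coe_eq_coe, Finset.sort_eq, Finset.image_val_of_injOn hinj]
    rfl

theorem IsModalBasis.eig_eq {d : ℕ} (hd : 0 < d) {L : (Fin d → ℕ) → MvPolynomial (Fin d) ℝ}
    (hL : IsModalBasis L) {n k : ℕ} (hk : k ≤ n) : eig d n k = durrmeyerEig d n k := by
  -- The sorted list has length `n + 1`, so for `k ≤ n` the default value `0` is never reached.
  rw [eig, hL.massEigenvalues_eq hd, sort_image_range_of_strictAntiOn (durrmeyerEig_strictAntiOn d n),
    List.getD_eq_getElem _ _ (by simpa using Nat.lt_succ_iff.mpr hk)]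
  simp

/-! ### Transposed degree elevation -/

/-- Column `β` of the elevation matrix writes `B^m_β` in the degree-`n` basis, so its transpose
turns degree-`n` moments into degree-`m` moments. -/
lemma elev_transpose_mulVec_mass {d m n : ℕ} (h : m ≤ n) (c : BernIdx d n → ℝ) (β : BernIdx d m) :
    ((elev d h)ᵀ *ᵥ (mass d n *ᵥ c)) β = l2 (bern β.1) (ofBernCoeff c) := by
  conv_rhs => rw [sum_elev_bern d h β, ← l2Form_apply, map_sum, LinearMap.sum_apply]
  simp only [Matrix.mulVec, dotProduct, Matrix.transpose_apply, map_smul, LinearMap.smul_apply,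
    smul_eq_mul, l2Form_apply, ← mass_mulVec_apply]

section Modal

variable {d : ℕ} {L : (Fin d → ℕ) → MvPolynomial (Fin d) ℝ} (hL : IsModalBasis L)
include hL

lemma ofBernCoeff_T (n : ℕ) (γ : ModalIdx d n) :
    ofBernCoeff (fun α => T hL n α γ) = L γ.1 := by
  rw [← modalBasis_apply hL n γ, ← ofBernCoeff_repr]
  rfl

lemma mass_mulVec_T (n : ℕ) (γ : ModalIdx d n) :
    mass d n *ᵥ (fun α => T hL n α γ) =
      durrmeyerEig d n (∑ j, γ.1 j) • fun α => T hL n α γ := by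
  rw [mass_mulVec_eq_smul_iff, ofBernCoeff_T, hL.durrmeyer_eq]

theorem elev_transpose_mul_T (hd : 0 < d) {m n : ℕ} (h : m ≤ n) :
    (elev d h)ᵀ * T hL n = T hL m * Dtilde d m n := by
  ext β γ
  have hpos : durrmeyerEig d n (∑ j, γ.1 j) ≠ 0 := (durrmeyerEig_pos γ.2).ne'
  -- The eigenvalue factor inserts the mass matrix before column `γ` of `T`, which makes the entry a
  -- moment of `L_γ`.
  have h1 : durrmeyerEig d n (∑ j, γ.1 j) * ((elev d h)ᵀ * T hL n) β γ = l2 (bern β.1) (L γ.1) := by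
    have h2 := elev_transpose_mulVec_mass h (fun α => T hL n α γ) β
    rw [mass_mulVec_T, Matrix.mulVec_smul, ofBernCoeff_T] at h2
    exact h2
  refine mul_left_cancel₀ hpos (h1.trans ?_)
  rw [Matrix.mul_apply]
  by_cases hγ : ∑ j, γ.1 j ≤ m
  · rw [Finset.sum_eq_single (⟨γ.1, hγ⟩ : ModalIdx d m)]
    · have h3 := congrFun (mass_mulVec_T hL m ⟨γ.1, hγ⟩) β
      rw [mass_mulVec_apply, ofBernCoeff_T] at h3
      rw [h3, Dtilde, Matrix.of_apply, if_pos rfl, hL.eig_eq hd hγ, hL.eig_eq hd γ.2,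
        Pi.smul_apply, smul_eq_mul]
      field_simp
    · intro ν _ hν
      rw [Dtilde, Matrix.of_apply, if_neg (fun e => hν (Subtype.ext e)), mul_zero]
    · simp
  -- For `|γ| > m` the moment vanishes by orthogonality, and no row index `ν` can equal `γ`.
  · rw [l2_comm, hL.l2_eq_zero γ.1 _ (mem_lowSpan_of_totalDegree_lt
      (((MvPolynomial.mem_restrictTotalDegree _ _ _).mp (bern_mem d m β)).trans_lt
        (not_le.mp hγ)))]
    refine (mul_eq_zero_of_right _ (Finset.sum_eq_zero fun ν _ => ?_)).symm
    rw [Dtilde, Matrix.of_apply, if_neg (fun e : ν.1 = γ.1 => hγ (e ▸ ν.2)), mul_zero]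

end Modal

end BernsteinModal

end

theorem mainTheorem3 (d : ℕ) (hd : 0 < d)
    (L : (Fin d → ℕ) → MvPolynomial (Fin d) ℝ) (hL : BernsteinModal.IsModalBasis L)
    (N i : ℕ) (hi : i ≤ N) :
    (∀ n : ℕ, (BernsteinModal.massEigenvalues d n).card = n + 1 ∧
      ∀ k ≤ n, 0 < BernsteinModal.eig d n k ∧
        ∀ c : BernsteinModal.BernIdx d n → ℝ,
          BernsteinModal.mass d n *ᵥ c = BernsteinModal.eig d n k • c ↔
            BernsteinModal.ofBernCoeff c ∈ BernsteinModal.P d k ∧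
              ∀ q : MvPolynomial (Fin d) ℝ, q.totalDegree < k →
                BernsteinModal.l2 (BernsteinModal.ofBernCoeff c) q = 0) ∧
    BernsteinModal.Tinv hL (N - i) * (BernsteinModal.elev d (Nat.sub_le N i))ᵀ *
        BernsteinModal.T hL N =
      BernsteinModal.Dtilde d (N - i) N := by
  refine ⟨fun n => ⟨?_, fun k hk => ⟨?_, fun c => ?_⟩⟩, ?_⟩
  · rw [hL.massEigenvalues_eq hd, Finset.card_image_of_injOn, Finset.card_range]
    exact fun a ha b hb h => (BernsteinModal.durrmeyerEig_strictAntiOn d n).injOn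
      (Nat.lt_succ_iff.mp (Finset.mem_range.mp ha)) (Nat.lt_succ_iff.mp (Finset.mem_range.mp hb)) h
  · rw [hL.eig_eq hd hk]
    exact BernsteinModal.durrmeyerEig_pos hk
  · rw [hL.eig_eq hd hk, BernsteinModal.mass_mulVec_eq_smul_iff,
      hL.durrmeyer_eq_smul_iff hk (BernsteinModal.ofBernCoeff_mem c)]
  · rw [Matrix.mul_assoc, BernsteinModal.elev_transpose_mul_T hL hd, ← Matrix.mul_assoc,
      BernsteinModal.Tinv_mul_T, Matrix.one_mul]
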